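/- Let $\eta$ be the law of an i.i.d. family $\omega=(\omega_i)_{i\in\mathbb Z}$ of random variables with values in $[0,1]$ (the environment), and put $\rho_i=(1-\omega_i)/\omega_i$. Assume that 1. there is an $\varepsilon_0>0$ with $\eta(\varepsilon_0\le\omega_0\le 1-\varepsilon_0)=1$; 2. $\int \log\rho_0\,d\eta=0$ (the recurrent case); 3. $\operatorname{Var}_\eta(\log\rho_0)>0$. Given $\omega$, let $P_\omega$ be the law of the Markov chain $(S_n)_{n\ge0}$ on $\mathbb Z$ with $S_0=0$ which jumps from $i$ to $i+1$ with probability $\omega_i$ and from $i$ to $i-1$ with probability $1-\omega_i$. Let $\mathbb P(\cdot)=\int P_\omega(\cdot)\,\eta(d\omega)$ be the annealed law, with expectation $\mathbb E$, and let $\tau_1=\inf\{n>0: S_n=1\}$ (with $\tau_1^\alpha e^{-r\tau_1}:=0$ if $\tau_1=\infty$). Then for every real $\alpha>0$, $$\mathbb E\left(\tau_1^{\alpha}e^{-r\tau_1}\right)=\left(\frac1r\right)^{\alpha+o(1)},\qquad r\to0^+ ;$$ that is, there is a function $o:\mathbb R\to\mathbb R$ with $o(r)\to0$ as $r\to0^+$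 such that, for all sufficiently small $r>0$, the expectation exists, is finite, and equals $(1/r)^{\alpha+o(r)}$. -/

import Mathlib

open MeasureTheory ProbabilityTheory Filter Topology

noncomputable section

namespace RWRE

/-- An environment: a family `(ω_i)` of numbers in `[0, 1]` indexed by `i ∈ ℤ`. -/
abbrev Env : Type := ℤ → unitInterval

/-- The one-step law of the walk at site `i`: it jumps to `i + 1` with probability `ω_i` and to
`i - 1` with probability `1 - ω_i`. -/
def stepLaw (ω : Env) (i : ℤ) : Measure ℤ :=
  ENNReal.ofReal (ω i : ℝ) • Measure.dirac (i + 1) +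
    ENNReal.ofReal (1 - (ω i : ℝ)) • Measure.dirac (i - 1)

instance (ω : Env) (i : ℤ) : IsProbabilityMeasure (stepLaw ω i) := ⟨by
  simp only [stepLaw, Measure.add_apply, Measure.smul_apply, measure_univ, smul_eq_mul, mul_one]
  rw [← ENNReal.ofReal_add (ω i).2.1 (sub_nonneg.2 (ω i).2.2)]
  simp⟩

/-- The transition kernel of the walk in the environment `ω`. -/
def stepKernel (ω : Env) : Kernel ℤ ℤ := Kernel.ofFunOfCountable (stepLaw ω)

instance (ω : Env) : IsMarkovKernel (stepKernel ω) :=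
  ⟨fun i => inferInstanceAs (IsProbabilityMeasure (stepLaw ω i))⟩

/-- The law of position `n + 1` given the path up to time `n`: it depends on the position at
time `n` only. -/
def pathKernel (ω : Env) (n : ℕ) : Kernel (Finset.Iic n → ℤ) ℤ :=
  (stepKernel ω).comap (fun h => h ⟨n, Finset.mem_Iic.2 le_rfl⟩) (measurable_pi_apply _)

instance (ω : Env) (n : ℕ) : IsMarkovKernel (pathKernel ω n) := by
  unfold pathKernel; infer_instance

/-- The quenched law `P_ω^x` on paths `(S_n)_{n ∈ ℕ}`: the law of the Markov chain with transition
kernel `stepKernel ω` started at `S_0 = x`. -/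
def quenchedLaw (ω : Env) (x : ℤ) : Measure (ℕ → ℤ) :=
  Kernel.trajMeasure (X := fun _ => ℤ) (Measure.dirac x) (pathKernel ω)

instance (ω : Env) (x : ℤ) : IsProbabilityMeasure (quenchedLaw ω x) := by
  unfold quenchedLaw; infer_instance

theorem quenchedLaw_start (ω : Env) (x y : ℤ) :
    quenchedLaw ω x {S | S 0 = y} = if x = y then 1 else 0 := by
  have hmap : (quenchedLaw ω x).map (Preorder.frestrictLe (π := fun _ => ℤ) 0) =
      (Measure.dirac x).map (MeasurableEquiv.piUnique (fun _ : Finset.Iic 0 => ℤ)).symm := by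
    rw [quenchedLaw, Kernel.trajMeasure, Measure.map_comp _ _ (by fun_prop),
      Kernel.traj_map_frestrictLe, Kernel.partialTraj_self]
    exact Measure.id_comp
  have h := congrArg (fun m => m {h | h ⟨0, Finset.mem_Iic.2 le_rfl⟩ = y}) hmap
  rw [Measure.map_apply (by fun_prop) (measurableSet_eq_fun (by fun_prop) (by fun_prop)),
    Measure.map_apply (by fun_prop) (measurableSet_eq_fun (by fun_prop) (by fun_prop)),
    Measure.dirac_apply] at h
  refine Eq.trans h ?_
  simp only [Set.indicator, Set.mem_preimage, Set.mem_ofPred_eq, Pi.one_apply]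
  rfl

theorem quenchedLaw_step (ω : Env) (x : ℤ) (p : ℕ → ℤ) (n : ℕ) :
    quenchedLaw ω x {S | ∀ i ≤ n + 1, S i = p i} =
      quenchedLaw ω x {S | ∀ i ≤ n, S i = p i} * stepLaw ω (p n) {p (n + 1)} := by
  have h := Kernel.map_frestrictLe_trajMeasure_compProd_eq_map_trajMeasure
    (X := fun _ => ℤ) (μ₀ := Measure.dirac x) (κ := pathKernel ω) (a := n)
  have h' := congrArg
    (fun m => m ({fun i : Finset.Iic n => p i} ×ˢ {p (n + 1)})) h
  have hm : MeasurableSet ({fun i : Finset.Iic n => p i} : Set (Finset.Iic n → ℤ)) :=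
    measurableSet_singleton _
  rw [Measure.compProd_apply_prod hm (measurableSet_singleton _),
    Measure.map_apply (by fun_prop) (hm.prod (measurableSet_singleton _)),
    lintegral_singleton, Measure.map_apply (by fun_prop) hm] at h'
  have e1 : {S : ℕ → ℤ | ∀ i ≤ n + 1, S i = p i} =
      (fun S : ℕ → ℤ => (Preorder.frestrictLe (π := fun _ => ℤ) n S, S (n + 1))) ⁻¹'
        ({fun i : Finset.Iic n => p i} ×ˢ {p (n + 1)}) := by
    ext S
    simp only [Set.mem_ofPred_eq, Set.mem_preimage, Set.mem_prod, Set.mem_singleton_iff, funext_iff,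
      Subtype.forall, Finset.mem_Iic, Preorder.frestrictLe_apply]
    constructor
    · exact fun H => ⟨fun i hi => H i (by omega), H _ le_rfl⟩
    · rintro ⟨H1, H2⟩ i hi
      rcases Nat.lt_or_ge n i with h | h
      · obtain rfl : i = n + 1 := by omega
        exact H2
      · exact H1 i h
  have e2 : {S : ℕ → ℤ | ∀ i ≤ n, S i = p i} =
      Preorder.frestrictLe (π := fun _ => ℤ) n ⁻¹' {fun i : Finset.Iic n => p i} := by
    ext S
    simp [funext_iff]
  rw [e1, e2, mul_comm]
  exact h'.symm

theorem measurable_stepLaw_singleton (i j : ℤ) :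
    Measurable fun ω : Env => stepLaw ω i {j} := by
  simp only [stepLaw, Measure.add_apply, Measure.smul_apply, smul_eq_mul]
  fun_prop

theorem measurable_quenchedLaw_path (x : ℤ) (p : ℕ → ℤ) (n : ℕ) :
    Measurable fun ω : Env => quenchedLaw ω x {S | ∀ i ≤ n, S i = p i} := by
  induction n with
  | zero => simp [quenchedLaw_start]
  | succ n ih =>
    simp only [quenchedLaw_step]
    exact ih.mul (measurable_stepLaw_singleton _ _)

/-- The quenched law is a measurable function of the environment. -/
theorem measurable_quenchedLaw (x : ℤ) : Measurable fun ω : Env => quenchedLaw ω x := by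
  refine Measurable.measure_of_isPiSystem_of_isProbabilityMeasure
    (generateFrom_measurableCylinders (α := fun _ : ℕ => ℤ)).symm
    isPiSystem_measurableCylinders fun s hs => ?_
  rw [measurableCylinders_nat] at hs
  simp only [Set.mem_iUnion, Set.mem_singleton_iff] at hs
  obtain ⟨n, A, -, rfl⟩ := hs
  have e : cylinder (Finset.Iic n) A = ⋃ h : A, {S : ℕ → ℤ | ∀ i ≤ n, S i =
      (fun j => if hj : j ∈ Finset.Iic n then h.1 ⟨j, hj⟩ else 0) i} := by
    ext S
    simp only [mem_cylinder, Set.mem_iUnion, Set.mem_ofPred_eq]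
    constructor
    · intro H
      refine ⟨⟨_, H⟩, fun i hi => ?_⟩
      simp [hi]
    · rintro ⟨⟨h, hA⟩, H⟩
      convert hA using 1
      ext ⟨i, hi⟩
      simpa [Finset.mem_Iic.1 hi] using H i (Finset.mem_Iic.1 hi)
  have hd : Pairwise fun h h' : A => Disjoint
      {S : ℕ → ℤ | ∀ i ≤ n, S i =
        (fun j => if hj : j ∈ Finset.Iic n then h.1 ⟨j, hj⟩ else 0) i}
      {S : ℕ → ℤ | ∀ i ≤ n, S i =
        (fun j => if hj : j ∈ Finset.Iic n then h'.1 ⟨j, hj⟩ else 0) i} := by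
    intro h h' hne
    refine Set.disjoint_left.2 fun S H H' => hne (Subtype.ext (funext fun ⟨i, hi⟩ => ?_))
    have := (H i (Finset.mem_Iic.1 hi)).symm.trans (H' i (Finset.mem_Iic.1 hi))
    simpa [Finset.mem_Iic.1 hi] using this
  have hms : ∀ p : ℕ → ℤ, MeasurableSet {S : ℕ → ℤ | ∀ i ≤ n, S i = p i} := fun p => by
    measurability
  simp only [e]
  have : ∀ ω : Env, _ := fun ω => measure_iUnion (μ := quenchedLaw ω x) hd fun h => hms _
  simp only [this]
  exact Measurable.tsum fun h => measurable_quenchedLaw_path x _ n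

/-- The annealed law `ℙ(·) = ∫ P_ω(·) η(dω)` of the walk started at `0`, where `η` is the law of
the environment. -/
def annealedLaw (η : Measure Env) : Measure (ℕ → ℤ) :=
  η.bind fun ω => quenchedLaw ω 0

theorem annealedLaw_apply (η : Measure Env) {A : Set (ℕ → ℤ)} (hA : MeasurableSet A) :
    annealedLaw η A = ∫⁻ ω, quenchedLaw ω 0 A ∂η :=
  Measure.bind_apply hA (measurable_quenchedLaw 0).aemeasurable

/-- `log ρ_i = log ((1 - ω_i) / ω_i)`. -/
def logRho (i : ℤ) (ω : Env) : ℝ := Real.log ((1 - (ω i : ℝ)) / (ω i : ℝ))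

/-- The hitting time `τ_a = inf {n > 0 : S_n = a}` of a path, which is `∞` if `a` is never hit. -/
def hittingTime (a : ℤ) (S : ℕ → ℤ) : ℕ∞ := ⨅ (n : ℕ) (_ : 0 < n ∧ S n = a), (n : ℕ∞)

/-- The value `t ^ α * e ^ (-r t)`, with the value `0` (the limit at infinity) for `t = ∞`. -/
def powExp (α r : ℝ) (t : ℕ∞) : ℝ :=
  if t = ⊤ then 0 else (t.toNat : ℝ) ^ α * Real.exp (-r * t.toNat)

end RWRE

end

/-! The upper bound is pointwise: `t ^ α * e ^ (-r t)` is at most `(α / r) ^ α` (`powExp_le`). The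
content is the lower bound. Fix a small `δ` and put `R = r ^ (1 - δ)`. If the quenched Laplace
transforms of `τ_1` at `r` and at `R` differ by a constant `c`, then `τ_1` is of order at least `1 /
R`, yet not large against `1 / r`, with quenched probability bounded below. Hence the quenched
expectation is at least a constant times `R ^ (-α)` (`le_integral_powExp_of_gap`).

Such a gap comes from a valley of the potential to the left of the origin. Read leftwards, the
potential falls by roughly `log (1 / R)` and then climbs about three times as much. The fall makes
leaving the valley take time at least of order `1 / R` with positive probability. It exceeds `log (1
/ R)` by at most a factor `1 + δ`, up to rounding, so the time spent is about `R ^ (-(1 + δ)) = r ^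
(-(1 - δ ^ 2))`, which is small against `1 / r`; the wall behind makes an escape to the left
negligible (`exists_laplace_gap`).

The analytic tool is a Riccati recursion. Writing the Laplace transform of the passage time from
`-n` to `1 - n` as `1 / (1 + X n)`, first-step analysis expresses `X n` through `X (n + 1)` with
multiplier `ρ_{-n}`. Both `X` and `1 / X` obey affine inequalities, so both are controlled by block
sums of `log ρ` (`IsRiccati.le_of_valley`, `IsRiccati.inv_le_of_descent`).

Valleys are not too rare (`exists_valley_prob`). Use `4 * K` blocks of length `M`, each with
increment of order `√M`, where `K` is about `log (1 / R) / √M`. By the central limit theorem each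
block behaves as required with probability at least some `p` not depending on `M`, so the valley has
probability at least `p ^ (4 * K)`, roughly `R ^ (4 * log (1 / p) / √M)`. For `M` large this is at
least a constant times `R ^ δ`. The annealed expectation is thus at least a constant times `R ^ (δ -
α)`, and `δ` is arbitrary. -/

noncomputable section

namespace RWRE

/-! ### Affine recursions over blocks -/

/-- Iterating an affine inequality with coefficients at most `B` over `m` steps. -/
theorem affine_iterate {v z : ℕ → ℝ} {b B : ℝ} (hb : 0 ≤ b)
    (hz : ∀ n, Real.exp (z n) ≤ B) (hv : ∀ n, v n ≤ b + Real.exp (z n) * v (n + 1)) (n m : ℕ) :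
    v n ≤ b * ∑ i ∈ Finset.range m, B ^ i +
      Real.exp (∑ i ∈ Finset.range m, z (n + i)) * v (n + m) := by
  have hB : 0 ≤ B := (Real.exp_pos _).le.trans (hz 0)
  induction m generalizing n with
  | zero => simp
  | succ m ih =>
    have h := ih (n + 1)
    have e1 : ∑ i ∈ Finset.range (m + 1), z (n + i) =
        z n + ∑ i ∈ Finset.range m, z (n + 1 + i) := by
      rw [Finset.sum_range_succ', add_comm]
      simp [add_assoc, add_comm 1]
    have e2 : ∑ i ∈ Finset.range (m + 1), B ^ i = 1 + B * ∑ i ∈ Finset.range m, B ^ i := by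
      rw [Finset.sum_range_succ', Finset.mul_sum]
      simp [pow_succ, mul_comm, add_comm]
    have hS : 0 ≤ b * ∑ i ∈ Finset.range m, B ^ i :=
      mul_nonneg hb (Finset.sum_nonneg fun i _ => pow_nonneg hB i)
    rw [e1, e2, Real.exp_add]
    calc v n ≤ b + Real.exp (z n) * v (n + 1) := hv n
      _ ≤ b + Real.exp (z n) * (b * ∑ i ∈ Finset.range m, B ^ i +
          Real.exp (∑ i ∈ Finset.range m, z (n + 1 + i)) * v (n + 1 + m)) := by gcongr
      _ = b + Real.exp (z n) * (b * ∑ i ∈ Finset.range m, B ^ i) +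
          Real.exp (z n) * Real.exp (∑ i ∈ Finset.range m, z (n + 1 + i)) * v (n + 1 + m) := by
        ring
      _ ≤ b + B * (b * ∑ i ∈ Finset.range m, B ^ i) +
          Real.exp (z n) * Real.exp (∑ i ∈ Finset.range m, z (n + 1 + i)) * v (n + 1 + m) := by
        gcongr
        exact hz n
      _ = _ := by rw [show n + 1 + m = n + (m + 1) by ring]; ring

/-- The bound `2 * D` reproduces itself, since `D + (1 / 2) * (2 * D) = 2 * D`. -/
theorem affine_iterate_contracting {v : ℕ → ℝ} {D a : ℝ} (ha : Real.exp (-a) ≤ 1 / 2)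
    (hD : 0 ≤ D) (j K : ℕ) (hv : ∀ i, j ≤ i → i < j + K → v i ≤ D + Real.exp (-a) * v (i + 1)) :
    v j ≤ 2 * D + Real.exp (-a * K) * v (j + K) := by
  induction K generalizing j with
  | zero => simpa using hD
  | succ K ih =>
    have h := ih (j + 1) fun i h1 h2 => hv i (by omega) (by omega)
    have h0 := hv j le_rfl (by omega)
    have e : Real.exp (-a * (K + 1 : ℕ)) = Real.exp (-a) * Real.exp (-a * K) := by
      rw [← Real.exp_add]; push_cast; ring_nf
    have h1 := mul_le_mul_of_nonneg_left h (Real.exp_pos (-a)).le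
    have h2 := mul_le_mul_of_nonneg_right ha (by positivity : 0 ≤ 2 * D)
    rw [e, show j + (K + 1) = j + 1 + K by ring]
    linarith

/-- The subtracted `D` is what lets the induction close: the step needs `D - e ^ A * D ≤ -D`, which
is `2 ≤ e ^ A`. -/
theorem affine_iterate_expanding {v : ℕ → ℝ} {D A : ℝ} (hA : 2 ≤ Real.exp A)
    (hD : 0 ≤ D) (j K : ℕ) (hv : ∀ i, j ≤ i → i < j + K → v i ≤ D + Real.exp A * v (i + 1)) :
    v j ≤ Real.exp (A * K) * (D + v (j + K)) - D := by
  induction K generalizing j with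
  | zero => simp
  | succ K ih =>
    have h := ih (j + 1) fun i h1 h2 => hv i (by omega) (by omega)
    have h0 := hv j le_rfl (by omega)
    have e : Real.exp (A * (K + 1 : ℕ)) = Real.exp A * Real.exp (A * K) := by
      rw [← Real.exp_add]; push_cast; ring_nf
    have h1 := mul_le_mul_of_nonneg_left h (Real.exp_pos A).le
    have h2 := mul_le_mul_of_nonneg_right hA hD
    rw [e, show j + (K + 1) = j + 1 + K by ring]
    linarith

/-! ### The Riccati recursion in a valley -/

/-- A nonnegative solution of the Riccati recursion satisfied by the reciprocal Laplace transforms of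
the passage times from `-n` to `1 - n`; `w n` is the jump probability to the right at `-n`. -/
structure IsRiccati (w : ℕ → ℝ) (s : ℝ) (X : ℕ → ℝ) : Prop where
  nonneg : ∀ n, 0 ≤ X n
  eq : ∀ n, X n = s / w n + (1 - w n) / w n * (X (n + 1) / (1 + X (n + 1)))

namespace IsRiccati

variable {w X : ℕ → ℝ} {s ε : ℝ}

theorem le_const (h : IsRiccati w s X) (hε : 0 < ε) (hw : ∀ n, ε ≤ w n ∧ w n ≤ 1 - ε)
    (hs : 0 ≤ s) (n : ℕ) : X n ≤ (s + 1) / ε := by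
  have h0 := h.nonneg (n + 1)
  have h1 : X (n + 1) / (1 + X (n + 1)) ≤ 1 := (div_le_one (by linarith)).2 (by linarith)
  have hw0 := hw n
  have hwp : 0 < w n := hε.trans_le hw0.1
  rw [h.eq n]
  calc s / w n + (1 - w n) / w n * (X (n + 1) / (1 + X (n + 1)))
      ≤ s / w n + (1 - w n) / w n * 1 := by
        gcongr
        exact div_nonneg (by linarith) hwp.le
    _ = (s + (1 - w n)) / w n := by ring
    _ ≤ (s + 1) / ε := by
        gcongr
        · linarith
        · exact hw0.1

theorem le_affine (h : IsRiccati w s X) (hε : 0 < ε) (hw : ∀ n, ε ≤ w n ∧ w n ≤ 1 - ε)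
    (hs : 0 ≤ s) (n : ℕ) : X n ≤ s / ε + (1 - w n) / w n * X (n + 1) := by
  have h0 := h.nonneg (n + 1)
  have hw0 := hw n
  have hwp : 0 < w n := hε.trans_le hw0.1
  have h1 : X (n + 1) / (1 + X (n + 1)) ≤ X (n + 1) := div_le_self h0 (by linarith)
  rw [h.eq n]
  gcongr
  · exact hw0.1
  · exact div_nonneg (by linarith) hwp.le

theorem le_self (h : IsRiccati w s X) (hε : 0 < ε) (hw : ∀ n, ε ≤ w n ∧ w n ≤ 1 - ε)
    (hs : 0 ≤ s) (n : ℕ) : s ≤ X n := by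
  have h0 := h.nonneg (n + 1)
  have hw0 := hw n
  have hwp : 0 < w n := hε.trans_le hw0.1
  have h1 : s ≤ s / w n := le_div_self hs hwp (by linarith)
  have h2 : 0 ≤ (1 - w n) / w n * (X (n + 1) / (1 + X (n + 1))) :=
    mul_nonneg (div_nonneg (by linarith) hwp.le) (div_nonneg h0 (by linarith))
  rw [h.eq n]
  linarith

/-- Without the term `s / w n`, passing to reciprocals turns the recursion into an exactly affine
one. -/
theorem inv_le_affine (h : IsRiccati w s X) (hε : 0 < ε) (hw : ∀ n, ε ≤ w n ∧ w n ≤ 1 - ε)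
    (hs : 0 < s) (n : ℕ) :
    (X n)⁻¹ ≤ ((1 - w n) / w n)⁻¹ + ((1 - w n) / w n)⁻¹ * (X (n + 1))⁻¹ := by
  have h0 : 0 < X (n + 1) := hs.trans_le (h.le_self hε hw hs.le _)
  have hw0 := hw n
  have hwp : 0 < w n := hε.trans_le hw0.1
  have hr : 0 < (1 - w n) / w n := div_pos (by linarith) hwp
  have h2 : (1 - w n) / w n * (X (n + 1) / (1 + X (n + 1))) ≤ X n := by
    rw [h.eq n]
    have : 0 ≤ s / w n := by positivity
    linarith
  calc (X n)⁻¹ ≤ ((1 - w n) / w n * (X (n + 1) / (1 + X (n + 1))))⁻¹ := by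
        gcongr
    _ = _ := by
        field_simp
        ring

end IsRiccati

/-- In an environment whose potential first descends over `K` blocks of length `M` and then climbs
over `3 * K` blocks, the solution of the Riccati recursion at `0` is small. -/
theorem IsRiccati.le_of_valley {w X : ℕ → ℝ} {s ε a A : ℝ} {M K : ℕ}
    (h : IsRiccati w s X) (hε : 0 < ε) (hw : ∀ n, ε ≤ w n ∧ w n ≤ 1 - ε) (hs : 0 ≤ s)
    (ha : Real.exp (-a) ≤ 1 / 2) (hA : 2 ≤ Real.exp A)
    (hdesc : ∀ j < K, ∑ i ∈ Finset.range M, Real.log ((1 - w (j * M + i)) / w (j * M + i)) ≤ A)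
    (hasc : ∀ j, K ≤ j → j < 4 * K →
      ∑ i ∈ Finset.range M, Real.log ((1 - w (j * M + i)) / w (j * M + i)) ≤ -a) :
    X 0 ≤ Real.exp (A * K) * (3 * (s / ε * ∑ i ∈ Finset.range M, (1 / ε) ^ i) +
      Real.exp (-a * (3 * K)) * ((s + 1) / ε)) := by
  set z : ℕ → ℝ := fun n => Real.log ((1 - w n) / w n) with hz
  have hrp : ∀ n, 0 < (1 - w n) / w n := fun n =>
    div_pos (by linarith [hw n]) (hε.trans_le (hw n).1)
  have hez : ∀ n, Real.exp (z n) = (1 - w n) / w n := fun n => Real.exp_log (hrp n)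
  have hzB : ∀ n, Real.exp (z n) ≤ 1 / ε := fun n => by
    rw [hez]
    have := hw n
    gcongr <;> linarith
  set D := s / ε * ∑ i ∈ Finset.range M, (1 / ε) ^ i with hD
  have hD0 : 0 ≤ D := by positivity
  have hblock : ∀ j, X (j * M) ≤ D +
      Real.exp (∑ i ∈ Finset.range M, z (j * M + i)) * X ((j + 1) * M) := fun j => by
    have := affine_iterate (v := X) (z := z) (b := s / ε) (by positivity) hzB
      (fun n => by rw [hez]; exact h.le_affine hε hw hs n) (j * M) M
    rwa [show j * M + M = (j + 1) * M by ring] at this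
  -- The first `K` blocks multiply by at most `e ^ A` each; the next `3 * K` blocks contract by `e ^
  -- (-a)` each.
  have h1 := affine_iterate_expanding (v := fun j => X (j * M)) hA hD0 0 K fun j _ hj =>
    (hblock j).trans (by
      have := h.nonneg ((j + 1) * M)
      gcongr
      exact hdesc j (by omega))
  have h2 := affine_iterate_contracting (v := fun j => X (j * M)) ha hD0 K (3 * K) fun j hj hj' =>
    (hblock j).trans (by
      have := h.nonneg ((j + 1) * M)
      gcongr
      exact hasc j hj (by omega))
  have h3 := h.le_const hε hw hs ((K + 3 * K) * M)
  simp only [zero_mul, zero_add] at h1 h2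
  push_cast at h2
  calc X 0 ≤ Real.exp (A * K) * (D + X (K * M)) - D := h1
    _ ≤ Real.exp (A * K) * (D + X (K * M)) := by linarith
    _ ≤ Real.exp (A * K) * (D + (2 * D + Real.exp (-a * (3 * K)) * ((s + 1) / ε))) := by
      gcongr
      exact h2.trans (by gcongr)
    _ = _ := by ring

/-- In an environment whose potential descends over `K` blocks of length `M`, the solution of the
Riccati recursion at `0` is not small. -/
theorem IsRiccati.inv_le_of_descent {w X : ℕ → ℝ} {s ε a : ℝ} {M K : ℕ}
    (h : IsRiccati w s X) (hε : 0 < ε) (hw : ∀ n, ε ≤ w n ∧ w n ≤ 1 - ε) (hs : 0 < s)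
    (ha : Real.exp (-a) ≤ 1 / 2)
    (hdesc : ∀ j < K, a ≤ ∑ i ∈ Finset.range M, Real.log ((1 - w (j * M + i)) / w (j * M + i))) :
    (X 0)⁻¹ ≤ 2 * (1 / ε * ∑ i ∈ Finset.range M, (1 / ε) ^ i) + Real.exp (-a * K) * s⁻¹ := by
  set z : ℕ → ℝ := fun n => -Real.log ((1 - w n) / w n) with hz
  have hrp : ∀ n, 0 < (1 - w n) / w n := fun n =>
    div_pos (by linarith [hw n]) (hε.trans_le (hw n).1)
  have hez : ∀ n, Real.exp (z n) = ((1 - w n) / w n)⁻¹ := fun n => by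
    rw [hz, Real.exp_neg, Real.exp_log (hrp n)]
  have hzB : ∀ n, Real.exp (z n) ≤ 1 / ε := fun n => by
    rw [hez, inv_div]
    have := hw n
    gcongr <;> linarith
  set D := 1 / ε * ∑ i ∈ Finset.range M, (1 / ε) ^ i with hD
  have hD0 : 0 ≤ D := by positivity
  have hblock : ∀ j, (X (j * M))⁻¹ ≤ D +
      Real.exp (∑ i ∈ Finset.range M, z (j * M + i)) * (X ((j + 1) * M))⁻¹ := fun j => by
    have := affine_iterate (v := fun n => (X n)⁻¹) (z := z) (b := 1 / ε) (by positivity) hzB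
      (fun n => (h.inv_le_affine hε hw hs n).trans
        (by rw [← hez]; gcongr; exact hzB n)) (j * M) M
    rwa [show j * M + M = (j + 1) * M by ring] at this
  have h1 := affine_iterate_contracting (v := fun j => (X (j * M))⁻¹) ha hD0 0 K fun j _ hj =>
    (hblock j).trans (by
      have := h.nonneg ((j + 1) * M)
      gcongr
      rw [hz]
      simp only [Finset.sum_neg_distrib, neg_le_neg_iff]
      exact hdesc j (by omega))
  -- At the bottom of the valley only the trivial bound `s ≤ X` is available; the factor `e ^ (-a *
  -- K)` compensates for it.
  have h2 := h.le_self hε hw hs.le (K * M)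
  simp only [zero_mul, zero_add] at h1
  refine h1.trans ?_
  gcongr

/-! ### From Laplace transforms to the Riccati recursion -/

/-- A bounded solution of the equation for the Laplace transforms of the hitting times of `1`
yields a solution of the Riccati recursion. -/
theorem isRiccati_of_harmonic {U w : ℕ → ℝ} {r ε : ℝ} (hr : 0 < r) (hε : 0 < ε)
    (hw : ∀ n, ε ≤ w n ∧ w n ≤ 1 - ε) (hU : ∀ n, 0 ≤ U n) (hU1 : ∀ n, U n ≤ 1) (hU0 : U 0 = 1)
    (heq : ∀ n, U (n + 1) = Real.exp (-r) * (w n * U n + (1 - w n) * U (n + 2))) :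
    IsRiccati w (Real.exp r - 1) fun n => U n / U (n + 1) - 1 := by
  have her : 1 < Real.exp r := Real.one_lt_exp_iff.2 hr
  have heq' : ∀ n, Real.exp r * U (n + 1) = w n * U n + (1 - w n) * U (n + 2) := fun n => by
    rw [heq n, ← mul_assoc, ← Real.exp_add]; simp
  have hpos : ∀ n, 0 < U n := fun n => by
    induction n with
    | zero => simp [hU0]
    | succ n ih =>
      rw [heq n]
      have h1 : 0 < w n * U n := mul_pos (hε.trans_le (hw n).1) ih
      have h2 : 0 ≤ (1 - w n) * U (n + 2) := mul_nonneg (by linarith [hw n]) (hU _)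
      positivity
  -- Since `e ^ r * U (n + 1)` is an average of `U n` and `U (n + 2)`, one increase forces the next,
  -- by a factor at least `e ^ r`. Iterating contradicts `U ≤ 1`, so `U` is antitone.
  have hgrow : ∀ n, U n < U (n + 1) → Real.exp r * U (n + 1) ≤ U (n + 2) := fun n h => by
    have hwn := hw n
    have h1 : w n * U n ≤ w n * (Real.exp r * U (n + 1)) := by
      have : 0 ≤ w n := by linarith
      gcongr
      nlinarith [hpos (n + 1)]
    have h2 : (1 - w n) * (Real.exp r * U (n + 1)) ≤ (1 - w n) * U (n + 2) := by
      linarith [heq' n]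
    exact le_of_mul_le_mul_left h2 (by linarith)
  have hanti : ∀ n, U (n + 1) ≤ U n := fun n => by
    by_contra! h
    have key : ∀ k, U (n + k) < U (n + k + 1) ∧ Real.exp r ^ k * U (n + 1) ≤ U (n + k + 1) := by
      intro k
      induction k with
      | zero => simpa using h
      | succ k ih =>
        have h1 := hgrow _ ih.1
        have h2 := hpos (n + k + 1)
        refine ⟨?_, ?_⟩
        · change U (n + k + 1) < U (n + k + 2)
          nlinarith
        · change _ ≤ U (n + k + 2)
          rw [pow_succ']
          have := mul_le_mul_of_nonneg_left ih.2 (Real.exp_pos r).le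
          linarith
    obtain ⟨k, hk⟩ := pow_unbounded_of_one_lt (1 / U (n + 1)) her
    have := (key k).2
    rw [div_lt_iff₀ (hpos _)] at hk
    linarith [hU1 (n + k + 1)]
  refine ⟨fun n => ?_, fun n => ?_⟩
  · rw [sub_nonneg, one_le_div (hpos _)]
    exact hanti n
  · have h1 := hpos n
    have h2 := hpos (n + 1)
    have h3 := hpos (n + 2)
    have hwp : 0 < w n := hε.trans_le (hw n).1
    simp only [show n + 1 + 1 = n + 2 from rfl, add_sub_cancel]
    field_simp
    linear_combination -heq' n

/-! ### Markov property and first-step analysis -/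

theorem measurableSet_path (p : ℕ → ℤ) (n : ℕ) :
    MeasurableSet {S : ℕ → ℤ | ∀ i ≤ n, S i = p i} := by
  measurability

theorem quenchedLaw_path (ω : Env) (x : ℤ) (p : ℕ → ℤ) (n : ℕ) :
    quenchedLaw ω x {S | ∀ i ≤ n, S i = p i} =
      (if x = p 0 then 1 else 0) * ∏ i ∈ Finset.range n, stepLaw ω (p i) {p (i + 1)} := by
  induction n with
  | zero => simp [quenchedLaw_start]
  | succ n ih => rw [quenchedLaw_step, ih, Finset.prod_range_succ, mul_assoc]

theorem ext_of_path {μ ν : Measure (ℕ → ℤ)} [IsFiniteMeasure μ] [IsFiniteMeasure ν]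
    (h : ∀ (p : ℕ → ℤ) (n : ℕ), μ {S | ∀ i ≤ n, S i = p i} = ν {S | ∀ i ≤ n, S i = p i}) :
    μ = ν := by
  -- Path segments up to time `n` form a countable space, so their law is determined by singletons.
  have hmap : ∀ n, μ.map (Preorder.frestrictLe (π := fun _ => ℤ) n) =
      ν.map (Preorder.frestrictLe (π := fun _ => ℤ) n) := fun n => by
    refine Measure.ext_of_singleton fun q => ?_
    rw [Measure.map_apply (by fun_prop) (measurableSet_singleton _),
      Measure.map_apply (by fun_prop) (measurableSet_singleton _)]
    have e : Preorder.frestrictLe (π := fun _ => ℤ) n ⁻¹' {q} =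
        {S : ℕ → ℤ | ∀ i ≤ n, S i =
          (fun j => if hj : j ∈ Finset.Iic n then q ⟨j, hj⟩ else 0) i} := by
      ext S
      simp only [Set.mem_preimage, Set.mem_singleton_iff, funext_iff, Subtype.forall,
        Finset.mem_Iic, Preorder.frestrictLe_apply, Set.mem_ofPred_eq]
      exact forall₂_congr fun i hi => by simp [hi]
    rw [e, h]
  refine ext_of_generate_finite _ (generateFrom_measurableCylinders (α := fun _ : ℕ => ℤ)).symm
    isPiSystem_measurableCylinders (fun s hs => ?_) ?_
  · rw [measurableCylinders_nat] at hs
    simp only [Set.mem_iUnion, Set.mem_singleton_iff] at hs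
    obtain ⟨n, A, hA, rfl⟩ := hs
    have := congrArg (fun m => m A) (hmap n)
    rw [Measure.map_apply (by fun_prop) hA, Measure.map_apply (by fun_prop) hA] at this
    exact this
  · have := congrArg (fun m => m Set.univ) (hmap 0)
    simpa only [Measure.map_apply (Preorder.measurable_frestrictLe 0) MeasurableSet.univ,
      Set.preimage_univ] using this

theorem quenchedLaw_ae_start (ω : Env) (x : ℤ) : ∀ᵐ S ∂(quenchedLaw ω x), S 0 = x := by
  have hm : MeasurableSet {S : ℕ → ℤ | S 0 = x} :=
    measurableSet_eq_fun (by fun_prop) (by fun_prop)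
  exact (mem_ae_iff_prob_eq_one hm).2 (by rw [quenchedLaw_start, if_pos rfl])

/-- The path after one step. -/
def shift (S : ℕ → ℤ) (n : ℕ) : ℤ := S (n + 1)

theorem measurable_shift : Measurable shift :=
  measurable_pi_lambda _ fun n => measurable_pi_apply (n + 1)

/-- The Markov property at time `1`. -/
theorem map_shift_quenchedLaw (ω : Env) (x : ℤ) :
    (quenchedLaw ω x).map shift = ENNReal.ofReal (ω x : ℝ) • quenchedLaw ω (x + 1) +
      ENNReal.ofReal (1 - (ω x : ℝ)) • quenchedLaw ω (x - 1) := by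
  have i1 : IsFiniteMeasure (ENNReal.ofReal (ω x : ℝ) • quenchedLaw ω (x + 1)) :=
    Measure.smul_finite _ ENNReal.ofReal_ne_top
  have i2 : IsFiniteMeasure (ENNReal.ofReal (1 - (ω x : ℝ)) • quenchedLaw ω (x - 1)) :=
    Measure.smul_finite _ ENNReal.ofReal_ne_top
  refine ext_of_path fun p n => ?_
  rw [Measure.map_apply measurable_shift (measurableSet_path p n)]
  -- The path `p` with the starting point `x` put in front.
  let p' : ℕ → ℤ := fun k => Nat.casesOn k x p
  have e : quenchedLaw ω x (shift ⁻¹' {S | ∀ i ≤ n, S i = p i}) =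
      quenchedLaw ω x {S | ∀ i ≤ n + 1, S i = p' i} := by
    refine measure_congr ?_
    filter_upwards [quenchedLaw_ae_start ω x] with S hS
    refine propext ⟨fun h i hi => ?_, fun h i hi => h (i + 1) (by omega)⟩
    cases i with
    | zero => exact hS
    | succ i => exact h i (by omega)
  rw [e, quenchedLaw_path, Finset.prod_range_succ']
  simp only [Measure.add_apply, Measure.smul_apply, smul_eq_mul, quenchedLaw_path]
  have e0 : stepLaw ω (p' 0) {p' (0 + 1)} = ENNReal.ofReal (ω x : ℝ) * (if x + 1 = p 0 then 1 else 0)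
      + ENNReal.ofReal (1 - (ω x : ℝ)) * (if x - 1 = p 0 then 1 else 0) := by
    simp [stepLaw, p', Set.indicator]
  rw [e0, if_pos (show x = p' 0 from rfl), one_mul]
  simp only [p']
  ring

/-- The first time `n ≥ 0` at which a path visits `1`. -/
def entryTime (S : ℕ → ℤ) : ℕ∞ := ⨅ (n : ℕ) (_ : S n = 1), (n : ℕ∞)

theorem hittingTime_eq (S : ℕ → ℤ) : hittingTime 1 S = 1 + entryTime (shift S) := by
  refine le_antisymm ?_ ?_
  · by_cases h : ∃ n, shift S n = 1
    · classical
      have hmin : entryTime (shift S) = (Nat.find h : ℕ∞) := by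
        refine le_antisymm (iInf₂_le (Nat.find h) (Nat.find_spec h)) (le_iInf₂ fun n hn => ?_)
        exact_mod_cast Nat.find_min' h hn
      rw [hmin]
      refine (iInf₂_le (Nat.find h + 1) ⟨by omega, Nat.find_spec h⟩).trans ?_
      push_cast
      rw [add_comm]
    · have : entryTime (shift S) = ⊤ := by
        simp only [entryTime, iInf_eq_top]
        exact fun n hn => (h ⟨n, hn⟩).elim
      simp [this]
  · refine le_iInf₂ fun n hn => ?_
    obtain ⟨m, rfl⟩ : ∃ m, n = m + 1 := ⟨n - 1, by omega⟩
    push_cast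
    rw [add_comm]
    gcongr
    exact iInf₂_le m hn.2

theorem entryTime_eq_hittingTime {S : ℕ → ℤ} (h : S 0 ≠ 1) : entryTime S = hittingTime 1 S := by
  refine le_antisymm (le_iInf₂ fun n hn => iInf₂_le n hn.2) (le_iInf₂ fun n hn => ?_)
  refine iInf₂_le n ⟨Nat.pos_of_ne_zero ?_, hn⟩
  rintro rfl
  exact h hn

theorem measurable_iInf_time {P : ℕ → (ℕ → ℤ) → Prop} (hP : ∀ n, MeasurableSet {S | P n S}) :
    Measurable fun S => ⨅ (n : ℕ) (_ : P n S), (n : ℕ∞) := by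
  classical
  have : BorelSpace ℕ∞ := ⟨borel_eq_top_of_countable.symm⟩
  refine Measurable.iInf fun n => ?_
  have : (fun S : ℕ → ℤ => ⨅ (_ : P n S), (n : ℕ∞)) = fun S => if P n S then (n : ℕ∞) else ⊤ := by
    ext S; split_ifs with h <;> simp [h]
  rw [this]
  exact Measurable.ite (hP n) measurable_const measurable_const

theorem measurable_hittingTime (a : ℤ) : Measurable (hittingTime a) :=
  measurable_iInf_time fun _ =>
    (MeasurableSet.const _).inter (measurableSet_eq_fun (by fun_prop) (by fun_prop))

theorem measurable_entryTime : Measurable entryTime :=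
  measurable_iInf_time fun _ => measurableSet_eq_fun (by fun_prop) (by fun_prop)

theorem measurable_powExp (α r : ℝ) : Measurable (powExp α r) := measurable_of_countable _

theorem powExp_nonneg (α r : ℝ) (t : ℕ∞) : 0 ≤ powExp α r t := by
  unfold powExp; split_ifs <;> positivity

theorem powExp_zero_le_one {r : ℝ} (hr : 0 ≤ r) (t : ℕ∞) : powExp 0 r t ≤ 1 := by
  unfold powExp
  split_ifs
  · exact zero_le_one
  · rw [Real.rpow_zero, one_mul, Real.exp_le_one_iff, neg_mul, neg_nonpos]
    positivity

theorem powExp_zero_one_add (r : ℝ) (t : ℕ∞) :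
    powExp 0 r (1 + t) = Real.exp (-r) * powExp 0 r t := by
  cases t with
  | top => simp [powExp]
  | coe n =>
    have : (1 + (n : ℕ∞)) = ((1 + n : ℕ) : ℕ∞) := by push_cast; rfl
    rw [this]
    simp only [powExp, ENat.natCast_ne_top, if_false, ENat.toNat_natCast, Real.rpow_zero, one_mul,
      ← Real.exp_add]
    push_cast
    ring_nf

/-- The Laplace transform of the entry time into `1` of the walk started at `x`. -/
def laplace (ω : Env) (r : ℝ) (x : ℤ) : ℝ := ∫ S, powExp 0 r (entryTime S) ∂(quenchedLaw ω x)

theorem integrable_laplace (ω : Env) {r : ℝ} (hr : 0 ≤ r) (x : ℤ) :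
    Integrable (fun S => powExp 0 r (entryTime S)) (quenchedLaw ω x) :=
  Integrable.of_bound ((measurable_powExp 0 r).comp measurable_entryTime).aestronglyMeasurable 1
    (ae_of_all _ fun S => by
      rw [Real.norm_of_nonneg (powExp_nonneg _ _ _)]; exact powExp_zero_le_one hr _)

theorem laplace_nonneg (ω : Env) (r : ℝ) (x : ℤ) : 0 ≤ laplace ω r x :=
  integral_nonneg fun _ => powExp_nonneg _ _ _

theorem laplace_le_one (ω : Env) {r : ℝ} (hr : 0 ≤ r) (x : ℤ) : laplace ω r x ≤ 1 := by
  refine (integral_mono (integrable_laplace ω hr x) (integrable_const 1)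
    fun S => powExp_zero_le_one hr _).trans ?_
  simp

theorem laplace_one (ω : Env) (r : ℝ) : laplace ω r 1 = 1 := by
  have : (fun S => powExp 0 r (entryTime S)) =ᵐ[quenchedLaw ω 1] fun _ => 1 := by
    filter_upwards [quenchedLaw_ae_start ω 1] with S hS
    have : entryTime S = 0 := le_antisymm (iInf₂_le 0 hS) zero_le
    simp [this, powExp]
  rw [laplace, integral_congr_ae this]
  simp

theorem laplace_step (ω : Env) {r : ℝ} (hr : 0 ≤ r) {x : ℤ} (hx : x ≠ 1) :
    laplace ω r x = Real.exp (-r) *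
      ((ω x : ℝ) * laplace ω r (x + 1) + (1 - (ω x : ℝ)) * laplace ω r (x - 1)) := by
  have h1 : (fun S => powExp 0 r (entryTime S)) =ᵐ[quenchedLaw ω x]
      fun S => Real.exp (-r) * powExp 0 r (entryTime (shift S)) := by
    filter_upwards [quenchedLaw_ae_start ω x] with S hS
    rw [entryTime_eq_hittingTime (by rwa [hS]), hittingTime_eq, powExp_zero_one_add]
  rw [laplace, integral_congr_ae h1, integral_const_mul]
  congr 1
  rw [← integral_map (f := fun S => powExp 0 r (entryTime S)) measurable_shift.aemeasurable
    ((measurable_powExp 0 r).comp measurable_entryTime).aestronglyMeasurable,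
    map_shift_quenchedLaw, integral_add_measure
      ((integrable_laplace ω hr _).smul_measure ENNReal.ofReal_ne_top)
      ((integrable_laplace ω hr _).smul_measure ENNReal.ofReal_ne_top),
    integral_smul_measure, integral_smul_measure, ENNReal.toReal_ofReal (ω x).2.1,
    ENNReal.toReal_ofReal (sub_nonneg.2 (ω x).2.2)]
  rfl

/-- In an elliptic environment the Laplace transform of the hitting time of `1` from `0` is
`1 / (1 + X 0)` for a solution `X` of the Riccati recursion. -/
theorem exists_isRiccati (ω : Env) {r ε : ℝ} (hr : 0 < r) (hε : 0 < ε)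
    (hw : ∀ n : ℕ, ε ≤ (ω (-n : ℤ) : ℝ) ∧ (ω (-n : ℤ) : ℝ) ≤ 1 - ε) :
    ∃ X, IsRiccati (fun n => (ω (-n : ℤ) : ℝ)) (Real.exp r - 1) X ∧
      ∫ S, powExp 0 r (hittingTime 1 S) ∂(quenchedLaw ω 0) = 1 / (1 + X 0) := by
  -- The index is offset by one: `U 0` belongs to the target `1`, and the equation for `U (n + 1)`
  -- uses the jump probability at `-n`. Taking ratios of successive `U` avoids the strong Markov
  -- property.
  refine ⟨_, isRiccati_of_harmonic (U := fun n => laplace ω r (1 - n)) hr hε hw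
    (fun n => laplace_nonneg _ _ _) (fun n => laplace_le_one ω hr.le _) ?_ fun n => ?_, ?_⟩
  · simpa using laplace_one ω r
  · have := laplace_step ω hr.le (x := -n) (by omega)
    push_cast
    rw [show (1 : ℤ) - (n + 1) = -n by ring, show (1 : ℤ) - (n + 2) = -n - 1 by ring,
      show (1 : ℤ) - n = -n + 1 by ring]
    exact this
  · have h1 : ∫ S, powExp 0 r (hittingTime 1 S) ∂(quenchedLaw ω 0) = laplace ω r 0 := by
      refine integral_congr_ae ?_
      filter_upwards [quenchedLaw_ae_start ω 0] with S hS
      rw [entryTime_eq_hittingTime (by simp [hS])]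
    rw [h1]
    simp [laplace_one]

/-! ### Block sums of i.i.d. variables and the probability of a valley -/

section Blocks

variable {Ω : Type*} {mΩ : MeasurableSpace Ω} {P : Measure Ω} {X : ℕ → Ω → ℝ}

/-- Normalized sums of centred i.i.d. variables charge each nonempty open set with a probability
bounded below. -/
theorem exists_eventually_le_measure_sum_mem [IsProbabilityMeasure P] (hm : MemLp (X 0) 2 P) (h0 : P[X 0] = 0)
    (hv : 0 < Var[X 0; P]) (hindep : iIndepFun X P)
    (hident : ∀ i, IdentDistrib (X i) (X 0) P P) {G : Set ℝ} (hG : IsOpen G) (hne : G.Nonempty) :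
    ∃ p : ENNReal, 0 < p ∧ ∀ᶠ n : ℕ in atTop,
      p ≤ P {ω | (√n)⁻¹ * ∑ k ∈ Finset.range n, X k ω ∈ G} := by
  have hv' : Var[X 0; P].toNNReal ≠ 0 := by simpa using hv
  -- The nondegenerate Gaussian limit charges `G`, and the portmanteau inequality for open sets
  -- gives any `p` strictly below that mass.
  have hclt := tendstoInDistribution_inv_sqrt_mul_sum_sub (X := X) (P := P)
    (Y := id) (P' := gaussianReal 0 Var[X 0; P].toNNReal) HasLaw.id hm hindep hident
  have hpos : 0 < gaussianReal 0 Var[X 0; P].toNNReal G := by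
    rw [pos_iff_ne_zero]
    intro h
    exact (hG.measure_pos volume hne).ne' (gaussianReal_absolutelyContinuous' 0 hv' h)
  have hlim := ProbabilityMeasure.le_liminf_measure_open_of_tendsto hclt.tendsto hG
  obtain ⟨p, hp0, hp⟩ := exists_between hpos
  refine ⟨p, hp0, ?_⟩
  have hlt : p < atTop.liminf fun n : ℕ => P.map
      (fun ω ↦ (√n)⁻¹ * (∑ k ∈ Finset.range n, X k ω - n * P[X 0])) G := by
    refine hp.trans_le (le_trans (le_of_eq ?_) hlim)
    simp
  filter_upwards [eventually_lt_of_lt_liminf hlt] with n hn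
  rw [Measure.map_apply_of_aemeasurable (hclt.forall_aemeasurable n) hG.measurableSet, h0] at hn
  simp only [mul_zero, sub_zero] at hn
  exact hn.le

theorem identDistrib_block (hindep : iIndepFun X P)
    (hident : ∀ i, IdentDistrib (X i) (X 0) P P) (m M : ℕ) :
    IdentDistrib (fun ω => ∑ i ∈ Finset.range M, X (m + i) ω)
      (fun ω => ∑ i ∈ Finset.range M, X i ω) P P :=
  (IdentDistrib.pi (X := fun i => X (m + i)) (Y := X)
    (fun i => (hident _).trans (hident i).symm)
    (hindep.precomp (g := fun i => m + i) (add_right_injective m)) hindep).comp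
    (u := fun x : ℕ → ℝ => ∑ i ∈ Finset.range M, x i) (by fun_prop)

theorem pow_le_measure_blocks [IsProbabilityMeasure P] (hX : ∀ i, Measurable (X i)) (hindep : iIndepFun X P)
    (hident : ∀ i, IdentDistrib (X i) (X 0) P P) (M : ℕ) {p : ENNReal} {I : ℕ → Set ℝ}
    (hI : ∀ j, MeasurableSet (I j))
    (hp : ∀ j, p ≤ P {ω | ∑ i ∈ Finset.range M, X i ω ∈ I j}) (n : ℕ) :
    p ^ n ≤ P {ω | ∀ j < n, ∑ i ∈ Finset.range M, X (j * M + i) ω ∈ I j} := by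
  induction n with
  | zero => simp
  | succ n ih =>
    have hind := hindep.indepFun_finset (Finset.range (n * M))
      (Finset.Ico (n * M) (n * M + M)) (by
        rw [Finset.disjoint_left]; intro a; simp; omega) hX
    have hmem : ∀ j < n, ∀ i ∈ Finset.range M, j * M + i ∈ Finset.range (n * M) := by
      intro j hj i hi
      rw [Finset.mem_range] at *
      calc j * M + i < j * M + M := by omega
        _ = (j + 1) * M := by ring
        _ ≤ n * M := Nat.mul_le_mul_right _ hj
    -- Block sums as functions of the coordinates in two disjoint index sets; the default `0` is
    -- never reached.
    let f : (Finset.range (n * M) → ℝ) → ℕ → ℝ := fun x j =>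
      ∑ i ∈ Finset.range M, if h : j * M + i ∈ Finset.range (n * M) then x ⟨_, h⟩ else 0
    let g : (Finset.Ico (n * M) (n * M + M) → ℝ) → ℝ := fun x =>
      ∑ i ∈ Finset.range M, if h : n * M + i ∈ Finset.Ico (n * M) (n * M + M) then x ⟨_, h⟩ else 0
    have hf : ∀ j, Measurable fun x => f x j := fun j => by
      refine Finset.measurable_sum _ fun i _ => ?_
      split_ifs <;> fun_prop
    have hg : Measurable g := by
      refine Finset.measurable_sum _ fun i _ => ?_
      split_ifs <;> fun_prop
    have hA : MeasurableSet {x : Finset.range (n * M) → ℝ | ∀ j < n, f x j ∈ I j} := by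
      have : {x : Finset.range (n * M) → ℝ | ∀ j < n, f x j ∈ I j} =
          ⋂ j, ⋂ (_ : j < n), (fun x => f x j) ⁻¹' I j := by ext; simp
      rw [this]
      exact MeasurableSet.iInter fun j => MeasurableSet.iInter fun _ => hf j (hI j)
    have key := hind.measure_inter_preimage_eq_mul _ _ hA (hg (hI n))
    have e1 : {ω | ∀ j < n, ∑ i ∈ Finset.range M, X (j * M + i) ω ∈ I j} =
        (fun ω (i : Finset.range (n * M)) => X i ω) ⁻¹' {x | ∀ j < n, f x j ∈ I j} := by
      ext ω
      refine forall₂_congr fun j hj => ?_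
      have : f (fun i => X i ω) j = ∑ i ∈ Finset.range M, X (j * M + i) ω :=
        Finset.sum_congr rfl fun i hi => by rw [dif_pos (hmem j hj i hi)]
      rw [this]
    have e2 : {ω | ∑ i ∈ Finset.range M, X (n * M + i) ω ∈ I n} =
        (fun ω (i : Finset.Ico (n * M) (n * M + M)) => X i ω) ⁻¹' (g ⁻¹' I n) := by
      ext ω
      have : g (fun i => X i ω) = ∑ i ∈ Finset.range M, X (n * M + i) ω :=
        Finset.sum_congr rfl fun i hi => by
          rw [dif_pos (by simp only [Finset.mem_range, Finset.mem_Ico] at *; omega)]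
      simp only [Set.mem_ofPred_eq, Set.mem_preimage, this]
    have e3 : {ω | ∀ j < n + 1, ∑ i ∈ Finset.range M, X (j * M + i) ω ∈ I j} =
        {ω | ∀ j < n, ∑ i ∈ Finset.range M, X (j * M + i) ω ∈ I j} ∩
          {ω | ∑ i ∈ Finset.range M, X (n * M + i) ω ∈ I n} := by
      ext ω
      simp only [Nat.forall_lt_succ_right]
      rfl
    have e4 : P {ω | ∑ i ∈ Finset.range M, X (n * M + i) ω ∈ I n} =
        P {ω | ∑ i ∈ Finset.range M, X i ω ∈ I n} :=
      (identDistrib_block hindep hident (n * M) M).measure_mem_eq (hI n)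
    rw [e3, e1, e2, key, ← e1, ← e2, e4, pow_succ]
    exact mul_le_mul' ih (hp n)

end Blocks

theorem measurable_logRho (i : ℤ) : Measurable (logRho i) := by
  unfold logRho
  fun_prop

/-- For a window of relative width `κ`, the blocks of some large length `M` realize a valley of
`4 * K` blocks, with a probability that decays in `K` at a rate small compared to `√M`. -/
theorem exists_valley_prob (η : Measure Env) [IsProbabilityMeasure η]
    (h_indep : iIndepFun (fun (i : ℤ) (ω : Env) => ω i) η)
    (h_ident : ∀ i : ℤ, IdentDistrib (fun ω : Env => ω i) (fun ω : Env => ω 0) η η)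
    (h_rec : ∫ ω, logRho 0 ω ∂η = 0) (h_var : 0 < variance (logRho 0) η)
    {κ : ℝ} (hκ : 0 < κ) :
    ∃ p : ℝ, 0 < p ∧ p ≤ 1 ∧ ∀ᶠ M : ℕ in atTop, ∀ K : ℕ, ENNReal.ofReal (p ^ (4 * K)) ≤
      η {ω | (∀ j < K, √M ≤ ∑ i ∈ Finset.range M, logRho (-(j * M + i : ℕ)) ω ∧
          ∑ i ∈ Finset.range M, logRho (-(j * M + i : ℕ)) ω ≤ (1 + κ) * √M) ∧
        ∀ j, K ≤ j → j < 4 * K → ∑ i ∈ Finset.range M, logRho (-(j * M + i : ℕ)) ω ≤ -√M} := by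
  set X : ℕ → Env → ℝ := fun n => logRho (-(n : ℤ)) with hXdef
  have hlog : Measurable fun x : unitInterval => Real.log ((1 - (x : ℝ)) / (x : ℝ)) := by fun_prop
  have hindep : iIndepFun X η :=
    (h_indep.comp (fun _ x => Real.log ((1 - (x : ℝ)) / (x : ℝ))) fun _ => hlog).precomp
      (g := fun n : ℕ => -(n : ℤ)) (fun a b h => by simpa using h)
  have hident : ∀ i, IdentDistrib (X i) (X 0) η η := fun i =>
    ((h_ident (-(i : ℤ))).trans (h_ident (-((0 : ℕ) : ℤ))).symm).comp hlog
  have hX : ∀ i, Measurable (X i) := fun i => measurable_logRho _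
  have hX0 : X 0 = logRho 0 := by simp [hXdef]
  have hm : MemLp (X 0) 2 η :=
    -- The real-valued variance is `0` off `L²`, so a nonzero variance already gives square
    -- integrability.
    memLp_two_of_variance_ne_zero (hX 0).aestronglyMeasurable (by rw [hX0]; exact h_var.ne')
  have h0 : η[X 0] = 0 := by rw [hX0]; exact h_rec
  have hv : 0 < Var[X 0; η] := by rw [hX0]; exact h_var
  obtain ⟨p₁, hp₁, h₁⟩ := exists_eventually_le_measure_sum_mem hm h0 hv hindep hident
    (isOpen_Ioo (a := (1 : ℝ)) (b := 1 + κ)) (Set.nonempty_Ioo.2 (by linarith))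
  obtain ⟨p₂, hp₂, h₂⟩ := exists_eventually_le_measure_sum_mem hm h0 hv hindep hident
    (isOpen_Iio (a := (-1 : ℝ))) Set.nonempty_Iio
  -- One bound serves both kinds of block; the cap at `1` keeps it finite and makes `log p`
  -- nonpositive later.
  set p' := min (min p₁ p₂) 1 with hp'
  have hp'1 : p' ≤ 1 := min_le_right _ _
  have hp'top : p' ≠ ⊤ := ne_top_of_le_ne_top ENNReal.one_ne_top hp'1
  have hp'0 : 0 < p' := lt_min (lt_min hp₁ hp₂) one_pos
  refine ⟨p'.toReal, ENNReal.toReal_pos hp'0.ne' hp'top,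
    ENNReal.toReal_le_of_le_ofReal zero_le_one (by simpa using hp'1), ?_⟩
  filter_upwards [h₁, h₂, eventually_gt_atTop 0] with M h₁ h₂ hM K
  rw [ENNReal.ofReal_pow ENNReal.toReal_nonneg, ENNReal.ofReal_toReal hp'top]
  have hsq : 0 < √(M : ℝ) := Real.sqrt_pos.2 (by exact_mod_cast hM)
  let I : ℕ → Set ℝ := fun j => if j < K then Set.Icc √M ((1 + κ) * √M) else Set.Iic (-√M)
  refine (pow_le_measure_blocks hX hindep hident M (p := p') (I := I) (fun j => ?_) (fun j => ?_)
    (4 * K)).trans (measure_mono fun ω hω => ⟨fun j hj => ?_, fun j hj hj' => ?_⟩)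
  · simp only [I]; split_ifs <;> measurability
  · simp only [I]
    split_ifs
    · refine ((min_le_left _ _).trans (min_le_left _ _)).trans (h₁.trans (measure_mono fun ω h => ?_))
      simp only [Set.mem_ofPred_eq, Set.mem_Ioo, inv_mul_eq_div, lt_div_iff₀ hsq,
        div_lt_iff₀ hsq, one_mul] at h
      exact ⟨h.1.le, h.2.le⟩
    · refine ((min_le_left _ _).trans (min_le_right _ _)).trans
        (h₂.trans (measure_mono fun ω h => ?_))
      simp only [Set.mem_ofPred_eq, Set.mem_Iio, inv_mul_eq_div, div_lt_iff₀ hsq] at h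
      simp only [Set.mem_ofPred_eq, Set.mem_Iic]
      linarith
  · have := hω j (by omega)
    simp only [I, if_pos hj] at this
    exact this
  · have := hω j hj'
    simp only [I, if_neg (not_lt.2 hj)] at this
    exact this

/-! ### Pointwise bounds and the use of a Laplace gap -/

theorem powExp_le {α r : ℝ} (hα : 0 < α) (hr : 0 < r) (t : ℕ∞) : powExp α r t ≤ (α / r) ^ α := by
  unfold powExp
  split_ifs
  · positivity
  · set x : ℝ := (t.toNat : ℝ)
    have hx : 0 ≤ x := Nat.cast_nonneg _
    -- From `y ≤ e ^ y` at `y = r * x / α`; raised to the power `α`, the exponential cancels `e ^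
    -- (-r x)`.
    have h1 : x ≤ α / r * Real.exp (r * x / α) := by
      have := Real.add_one_le_exp (r * x / α)
      calc x = α / r * (r * x / α) := by field_simp
        _ ≤ _ := by gcongr; linarith
    calc x ^ α * Real.exp (-r * x) ≤ (α / r * Real.exp (r * x / α)) ^ α * Real.exp (-r * x) := by
          gcongr
      _ = (α / r) ^ α * (Real.exp (r * x) * Real.exp (-r * x)) := by
          rw [Real.mul_rpow (by positivity) (Real.exp_pos _).le, ← Real.exp_mul,
            div_mul_cancel₀ _ hα.ne', mul_assoc]
      _ = (α / r) ^ α := by rw [← Real.exp_add]; simp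

/-- For `R t ≤ θ` the difference is at most `1 - e ^ (-θ)`, hence at most `θ`; otherwise `(R t / θ)
^ α ≥ 1` can be inserted in front of `e ^ (-r t)`. -/
theorem powExp_zero_sub_le {α r R θ : ℝ} (hα : 0 < α) (hr : 0 ≤ r) (hR : 0 < R) (hθ : 0 < θ)
    (t : ℕ∞) : powExp 0 r t - powExp 0 R t ≤ θ + (R / θ) ^ α * powExp α r t := by
  unfold powExp
  split_ifs
  · simpa using hθ.le
  · set x : ℝ := (t.toNat : ℝ)
    have hx : 0 ≤ x := Nat.cast_nonneg _
    simp only [Real.rpow_zero, one_mul]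
    rcases le_total (R * x) θ with h | h
    · have h1 : Real.exp (-r * x) ≤ 1 := Real.exp_le_one_iff.2 (by nlinarith)
      have h2 := Real.add_one_le_exp (-R * x)
      have h3 : 0 ≤ (R / θ) ^ α * (x ^ α * Real.exp (-r * x)) := by positivity
      linarith
    · have h1 : 1 ≤ (R / θ) ^ α * x ^ α := by
        rw [← Real.mul_rpow (by positivity) hx]
        refine Real.one_le_rpow ?_ hα.le
        rw [div_mul_eq_mul_div, one_le_div hθ]
        exact h
      have h2 := mul_le_mul_of_nonneg_right h1 (Real.exp_pos (-r * x)).le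
      have h3 := Real.exp_pos (-R * x)
      linarith

theorem integrable_powExp {α r : ℝ} (hα : 0 < α) (hr : 0 < r) (μ : Measure (ℕ → ℤ))
    [IsFiniteMeasure μ] : Integrable (fun S => powExp α r (hittingTime 1 S)) μ :=
  Integrable.of_bound
    ((measurable_powExp α r).comp (measurable_hittingTime 1)).aestronglyMeasurable ((α / r) ^ α)
    (ae_of_all _ fun S => by
      rw [Real.norm_of_nonneg (powExp_nonneg _ _ _)]; exact powExp_le hα hr _)

theorem integrable_powExp_zero {r : ℝ} (hr : 0 ≤ r) (μ : Measure (ℕ → ℤ))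
    [IsFiniteMeasure μ] : Integrable (fun S => powExp 0 r (hittingTime 1 S)) μ :=
  Integrable.of_bound
    ((measurable_powExp 0 r).comp (measurable_hittingTime 1)).aestronglyMeasurable 1
    (ae_of_all _ fun S => by
      rw [Real.norm_of_nonneg (powExp_nonneg _ _ _)]; exact powExp_zero_le_one hr _)

/-- A gap `c` between the Laplace transforms at `r` and `R` bounds `τ ^ α * e ^ (-r τ)` below. -/
theorem le_integral_powExp_of_gap {μ : Measure (ℕ → ℤ)} [IsProbabilityMeasure μ] {α r R c : ℝ}
    (hα : 0 < α) (hr : 0 < r) (hR : 0 < R) (hc : 0 < c)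
    (h : c ≤ ∫ S, powExp 0 r (hittingTime 1 S) ∂μ - ∫ S, powExp 0 R (hittingTime 1 S) ∂μ) :
    (c / 2 / R) ^ α * (c / 2) ≤ ∫ S, powExp α r (hittingTime 1 S) ∂μ := by
  rw [← integral_sub (integrable_powExp_zero hr.le μ) (integrable_powExp_zero hR.le μ)] at h
  -- With `θ = c / 2`, half of the gap is left for the moment term.
  have h1 := integral_mono
    ((integrable_powExp_zero hr.le μ).sub (integrable_powExp_zero hR.le μ))
    ((integrable_const (c / 2)).add ((integrable_powExp hα hr μ).const_mul ((R / (c / 2)) ^ α)))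
    fun S => powExp_zero_sub_le hα hr.le hR (half_pos hc) (hittingTime 1 S)
  simp only [Pi.add_apply, Pi.sub_apply] at h1
  rw [integral_add (integrable_const _) ((integrable_powExp hα hr μ).const_mul _),
    integral_const_mul] at h1
  simp only [integral_const, probReal_univ, smul_eq_mul, one_mul] at h1
  have h2 : c / 2 ≤ (R / (c / 2)) ^ α * ∫ S, powExp α r (hittingTime 1 S) ∂μ := by linarith
  rw [← inv_div, Real.inv_rpow (by positivity), inv_mul_le_iff₀ (by positivity)]
  exact h2

/-! ### The quenched gap in a valley -/

/-- The sum of `log ρ` over the `j`-th block of length `M` to the left of the origin. -/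
def blockSum (M j : ℕ) (ω : Env) : ℝ := ∑ i ∈ Finset.range M, logRho (-(j * M + i : ℕ)) ω

/-- The environments with a valley of `4 * K` blocks of length `M` to the left of the origin. -/
def valley (κ : ℝ) (M K : ℕ) : Set Env :=
  {ω | (∀ j < K, √M ≤ blockSum M j ω ∧ blockSum M j ω ≤ (1 + κ) * √M) ∧
    ∀ j, K ≤ j → j < 4 * K → blockSum M j ω ≤ -√M}

/-- The number of blocks of height at least `a` needed for a valley of depth `log (1 / R)`. -/
def valleySize (a R : ℝ) : ℕ := ⌈-Real.log R / a⌉₊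

theorem exp_neg_mul_valleySize_le {a R : ℝ} (ha : 0 < a) (hR : 0 < R) :
    Real.exp (-a * valleySize a R) ≤ R := by
  rw [← Real.le_log_iff_exp_le hR]
  have := Nat.le_ceil (-Real.log R / a)
  rw [div_le_iff₀ ha] at this
  unfold valleySize
  linarith

theorem valleySize_le {a R : ℝ} (ha : 0 < a) (hR : 0 < R) (hR1 : R ≤ 1) :
    valleySize a R ≤ -Real.log R / a + 1 :=
  (Nat.ceil_lt_add_one (div_nonneg (neg_nonneg.2 (Real.log_nonpos hR.le hR1)) ha.le)).le

/-- The Riccati solution at rate `R` stays above a constant `b`, by the descent alone, while at rate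
`r` it tends to `0`, by descent and wall together. The constant depends on `M` and `ε` but not on
`r`. -/
theorem exists_laplace_gap {ε δ : ℝ} (hε : 0 < ε) (hδ : 0 < δ) (hδ1 : δ < 1) {M : ℕ}
    (hM : Real.exp (-√M) ≤ 1 / 2) :
    ∃ c, 0 < c ∧ ∀ᶠ r in 𝓝[>] (0 : ℝ), ∀ ω ∈ valley δ M (valleySize √M (r ^ (1 - δ))),
      (∀ n : ℕ, ε ≤ (ω (-n : ℤ) : ℝ) ∧ (ω (-n : ℤ) : ℝ) ≤ 1 - ε) →
      c ≤ ∫ S, powExp 0 r (hittingTime 1 S) ∂(quenchedLaw ω 0) -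
        ∫ S, powExp 0 (r ^ (1 - δ)) (hittingTime 1 S) ∂(quenchedLaw ω 0) := by
  set a := √(M : ℝ) with ha_def
  have ha : 0 < a := by
    by_contra! h
    have : 1 ≤ Real.exp (-a) := Real.one_le_exp (by linarith)
    linarith
  have ha2 : 2 ≤ Real.exp a := by
    rw [Real.exp_neg] at hM
    have := (inv_le_comm₀ (Real.exp_pos a) (by norm_num)).1 hM
    norm_num at this
    exact this
  set D := 1 / ε * ∑ i ∈ Finset.range M, (1 / ε) ^ i with hD
  have hD0 : 0 ≤ D := by positivity
  -- Reciprocal of the descent bound: `2 * D` from the blocks and at most `1` from the bottom term,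
  -- since `e ^ (-a * K) ≤ R ≤ e ^ R - 1`.
  set b := 1 / (2 * D + 1) with hb
  have hb0 : 0 < b := by positivity
  -- The exponents are those of `r * R ^ (-(1 + δ))` and `R ^ (3 - (1 + δ))` with `R = r ^ (1 - δ)`.
  have hg : Tendsto (fun r : ℝ => Real.exp (a * (1 + δ)) * (6 * D * r ^ (δ ^ 2) +
      3 / ε * r ^ ((1 - δ) * (2 - δ)))) (𝓝[>] 0) (𝓝 0) := by
    have h1 : ∀ y : ℝ, 0 < y → Tendsto (fun r : ℝ => r ^ y) (𝓝[>] 0) (𝓝 0) := fun y hy => by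
      have := (Real.continuousAt_rpow_const 0 y (Or.inr hy.le)).tendsto
      rw [Real.zero_rpow hy.ne'] at this
      exact this.mono_left nhdsWithin_le_nhds
    have h2 := (((h1 (δ ^ 2) (by positivity)).const_mul (6 * D)).add
      ((h1 ((1 - δ) * (2 - δ)) (mul_pos (by linarith) (by linarith))).const_mul (3 / ε))).const_mul
        (Real.exp (a * (1 + δ)))
    simpa using h2
  refine ⟨1 / (1 + b / 2) - 1 / (1 + b), ?_, ?_⟩
  · rw [sub_pos]
    exact one_div_lt_one_div_of_lt (by positivity) (by linarith)
  filter_upwards [hg.eventually (ge_mem_nhds (half_pos hb0)), self_mem_nhdsWithin,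
    nhdsWithin_le_nhds (gt_mem_nhds (zero_lt_one : (0 : ℝ) < 1))] with r hr hr0 hr1 ω hω hell
  have hr0 : 0 < r := hr0
  set R := r ^ (1 - δ) with hR
  have hR0 : 0 < R := Real.rpow_pos_of_pos hr0 _
  have hR1 : R ≤ 1 := Real.rpow_le_one hr0.le hr1.le (by linarith)
  set K := valleySize a R with hK
  obtain ⟨X, hX, eX⟩ := exists_isRiccati ω hr0 hε hell
  obtain ⟨Y, hY, eY⟩ := exists_isRiccati ω hR0 hε hell
  have hdeep : Real.exp (-a * K) ≤ R := exp_neg_mul_valleySize_le ha hR0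
  have hS : R ≤ Real.exp R - 1 := by linarith [Real.add_one_le_exp R]
  have hs : Real.exp r - 1 ≤ 2 * r := by
    have := Real.abs_exp_sub_one_le (x := r) (by rw [abs_of_pos hr0]; exact hr1.le)
    rw [abs_of_pos hr0] at this
    exact (le_abs_self _).trans this
  have hs0 : 0 ≤ Real.exp r - 1 := by linarith [Real.add_one_le_exp r]
  have hYb : b ≤ Y 0 := by
    have h1 := hY.inv_le_of_descent hε hell (hR0.trans_le hS) hM fun j hj => (hω.1 j hj).1
    have h2 : Real.exp (-a * K) * (Real.exp R - 1)⁻¹ ≤ 1 := by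
      rw [mul_inv_le_iff₀ (hR0.trans_le hS)]
      linarith
    have hY0 : 0 < Y 0 := (hR0.trans_le hS).trans_le (hY.le_self hε hell (hR0.le.trans hS) 0)
    rw [hb, one_div, inv_le_comm₀ (by positivity) hY0]
    exact h1.trans (by linarith)
  have hXb : X 0 ≤ b / 2 := by
    have h1 := hX.le_of_valley (A := (1 + δ) * a) hε hell hs0 hM
      (ha2.trans (Real.exp_le_exp.2 (by nlinarith))) (fun j hj => (hω.1 j hj).2) hω.2
    refine (h1.trans ?_).trans hr
    -- Rounding `K` up costs at most one block, which is the factor `e ^ (a * (1 + δ))`.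
    have e1 : Real.exp ((1 + δ) * a * K) ≤ Real.exp (a * (1 + δ)) * R ^ (-(1 + δ)) := by
      rw [Real.rpow_def_of_pos hR0, ← Real.exp_add, Real.exp_le_exp]
      have := valleySize_le ha hR0 hR1
      have h3 : a * K ≤ -Real.log R + a := by
        calc a * K ≤ a * (-Real.log R / a + 1) := by gcongr
          _ = _ := by field_simp
      nlinarith
    have e2 : Real.exp (-a * (3 * K)) ≤ R ^ (3 : ℝ) := by
      calc Real.exp (-a * (3 * K)) = Real.exp (-a * K) ^ 3 := by
            rw [← Real.exp_nat_mul]; push_cast; ring_nf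
        _ ≤ R ^ 3 := by gcongr
        _ = R ^ (3 : ℝ) := by norm_cast
    have e3 : (Real.exp r - 1) / ε * ∑ i ∈ Finset.range M, (1 / ε) ^ i ≤ 2 * r * D := by
      rw [hD, ← mul_assoc, mul_one_div]
      gcongr
    have e4 : (Real.exp r - 1 + 1) / ε ≤ 3 / ε := by
      gcongr
      linarith
    calc _ ≤ Real.exp (a * (1 + δ)) * R ^ (-(1 + δ)) *
          (3 * (2 * r * D) + R ^ (3 : ℝ) * (3 / ε)) := by
          gcongr
      _ = Real.exp (a * (1 + δ)) * (6 * D * (R ^ (-(1 + δ)) * r) +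
          3 / ε * (R ^ (-(1 + δ)) * R ^ (3 : ℝ))) := by ring
      _ = _ := by
          rw [← Real.rpow_add hR0, hR, ← Real.rpow_mul hr0.le, ← Real.rpow_mul hr0.le]
          nth_rewrite 2 [← Real.rpow_one r]
          rw [← Real.rpow_add hr0]
          ring_nf
  have hX0 := hX.nonneg 0
  rw [eX, eY]
  gcongr

/-! ### The annealed lower bound -/

/-- Lower bound for the annealed expectation. -/
theorem exists_le_integral_powExp (η : Measure Env) [IsProbabilityMeasure η]
    (h_indep : iIndepFun (fun (i : ℤ) (ω : Env) => ω i) η)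
    (h_ident : ∀ i : ℤ, IdentDistrib (fun ω : Env => ω i) (fun ω : Env => ω 0) η η)
    (h_ellip : ∃ ε₀ : ℝ, 0 < ε₀ ∧ ∀ᵐ ω ∂η, ε₀ ≤ (ω 0 : ℝ) ∧ (ω 0 : ℝ) ≤ 1 - ε₀)
    (h_rec : ∫ ω, logRho 0 ω ∂η = 0) (h_var : 0 < variance (logRho 0) η)
    {α δ : ℝ} (hα : 0 < α) (hδ : 0 < δ) (hδ1 : δ < 1) :
    ∃ C, 0 < C ∧ ∀ᶠ r in 𝓝[>] (0 : ℝ), C * r ^ ((1 - δ) * (δ - α)) ≤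
      ∫ S, powExp α r (hittingTime 1 S) ∂(annealedLaw η) := by
  obtain ⟨ε, hε, hell⟩ := h_ellip
  have hell' : ∀ᵐ ω ∂η, ∀ n : ℕ, ε ≤ (ω (-n : ℤ) : ℝ) ∧ (ω (-n : ℤ) : ℝ) ≤ 1 - ε := by
    rw [ae_all_iff]
    intro n
    have hm : MeasurableSet {x : unitInterval | ε ≤ (x : ℝ) ∧ (x : ℝ) ≤ 1 - ε} :=
      measurableSet_Icc.preimage measurable_subtype_coe
    exact (h_ident (-n : ℤ)).symm.ae_snd hm hell
  obtain ⟨p, hp0, hp1, hp⟩ := exists_valley_prob η h_indep h_ident h_rec h_var hδ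
  have hsqrt : Tendsto (fun M : ℕ => √(M : ℝ)) atTop atTop :=
    Real.tendsto_sqrt_atTop.comp tendsto_natCast_atTop_atTop
  -- `M` depends on `δ` and `p` only: `√M ≥ log 2` gives contraction by `1 / 2` per block, and `√M ≥
  -- 4 * log (1 / p) / δ` makes the valley cost at most `R ^ δ` up to a constant.
  obtain ⟨M, hpM, hM1, hM2⟩ := (hp.and ((hsqrt.eventually_ge_atTop (Real.log 2)).and
    (hsqrt.eventually_ge_atTop (4 * -Real.log p / δ)))).exists
  set a := √(M : ℝ) with ha_def
  have ha : 0 < a := (Real.log_pos one_lt_two).trans_le hM1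
  have hexp : Real.exp (-a) ≤ 1 / 2 := by
    rw [Real.exp_neg, one_div]
    exact inv_anti₀ two_pos ((Real.log_le_iff_le_exp two_pos).1 hM1)
  obtain ⟨c, hc, hgap⟩ := exists_laplace_gap hε hδ hδ1 hexp
  refine ⟨(c / 2) ^ α * (c / 2) * p ^ 4, by positivity, ?_⟩
  filter_upwards [hgap, self_mem_nhdsWithin,
    nhdsWithin_le_nhds (gt_mem_nhds (zero_lt_one : (0 : ℝ) < 1))] with r hr hr0 hr1
  have hr0 : 0 < r := hr0
  set R := r ^ (1 - δ) with hR
  have hR0 : 0 < R := Real.rpow_pos_of_pos hr0 _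
  have hR1 : R ≤ 1 := Real.rpow_le_one hr0.le hr1.le (by linarith)
  set K := valleySize a R with hK
  -- The factor `p ^ 4` pays for rounding `K` up.
  have hprob : p ^ 4 * R ^ δ ≤ p ^ (4 * K) := by
    have h1 := valleySize_le ha hR0 hR1
    have hlp : 0 ≤ -Real.log p := neg_nonneg.2 (Real.log_nonpos hp0.le hp1)
    have hlR : 0 ≤ -Real.log R := neg_nonneg.2 (Real.log_nonpos hR0.le hR1)
    rw [← Real.log_le_log_iff (by positivity) (by positivity), Real.log_mul (by positivity)
      (by positivity), Real.log_pow, Real.log_pow, Real.log_rpow hR0]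
    push_cast
    rw [div_le_iff₀ hδ] at hM2
    have h2 : (4 * -Real.log p) * K ≤ (4 * -Real.log p) * (-Real.log R / a + 1) := by gcongr
    have h3 : (4 * -Real.log p) * (-Real.log R / a) ≤ δ * -Real.log R := by
      rw [← mul_div_assoc, div_le_iff₀ ha]
      nlinarith
    linarith
  set c' := (c / 2 / R) ^ α * (c / 2) with hc'
  have hc'0 : 0 ≤ c' := by positivity
  have hmeas : Measurable fun S => ENNReal.ofReal (powExp α r (hittingTime 1 S)) :=
    ((measurable_powExp α r).comp (measurable_hittingTime 1)).ennreal_ofReal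
  have : IsProbabilityMeasure (annealedLaw η) := ⟨by simp [annealedLaw_apply η MeasurableSet.univ]⟩
  have hlow : ENNReal.ofReal (c' * p ^ (4 * K)) ≤
      ENNReal.ofReal (∫ S, powExp α r (hittingTime 1 S) ∂(annealedLaw η)) := by
    rw [ofReal_integral_eq_lintegral_ofReal (integrable_powExp hα hr0 _)
      (ae_of_all _ fun S => powExp_nonneg _ _ _), annealedLaw,
      Measure.lintegral_bind (measurable_quenchedLaw 0).aemeasurable hmeas.aemeasurable]
    -- Markov's inequality in the environment: almost every valley lies in the event that the
    -- quenched expectation is at least `c'`.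
    calc ENNReal.ofReal (c' * p ^ (4 * K))
        = ENNReal.ofReal c' * ENNReal.ofReal (p ^ (4 * K)) := ENNReal.ofReal_mul hc'0
      _ ≤ ENNReal.ofReal c' * η {ω | ENNReal.ofReal c' ≤
          ∫⁻ S, ENNReal.ofReal (powExp α r (hittingTime 1 S)) ∂(quenchedLaw ω 0)} := by
        gcongr
        refine (hpM K).trans (measure_mono_ae ?_)
        filter_upwards [hell'] with ω hω hv
        change ENNReal.ofReal c' ≤ _
        rw [← ofReal_integral_eq_lintegral_ofReal (integrable_powExp hα hr0 _)
          (ae_of_all _ fun S => powExp_nonneg _ _ _)]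
        exact ENNReal.ofReal_le_ofReal
          (le_integral_powExp_of_gap hα hr0 hR0 hc (hr ω hv hω))
      _ ≤ _ := mul_meas_ge_le_lintegral
          ((Measure.measurable_lintegral hmeas).comp (measurable_quenchedLaw 0)) _
  refine le_trans ?_ ((ENNReal.ofReal_le_ofReal_iff
    (integral_nonneg fun S => powExp_nonneg _ _ _)).1 hlow)
  calc (c / 2) ^ α * (c / 2) * p ^ 4 * r ^ ((1 - δ) * (δ - α))
      = (c / 2) ^ α * (c / 2) * p ^ 4 * (R ^ δ / R ^ α) := by
        rw [Real.rpow_mul hr0.le, ← hR, Real.rpow_sub hR0]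
    _ = c' * (p ^ 4 * R ^ δ) := by
        rw [hc', Real.div_rpow (by positivity) hR0.le]; ring
    _ ≤ c' * p ^ (4 * K) := by gcongr

/-! ### Extracting the exponent -/

/-- A positive quantity comparable to `r ^ (-α)` up to arbitrarily small powers is
`(1 / r) ^ (α + o(1))`. -/
theorem exists_exponent {F : ℝ → ℝ} {α B : ℝ} (hα : 0 < α) (hB : 0 < B)
    (hup : ∀ᶠ r in 𝓝[>] (0 : ℝ), F r ≤ B * r ^ (-α))
    (hlow : ∀ δ, 0 < δ → δ < 1 → ∃ C, 0 < C ∧ ∀ᶠ r in 𝓝[>] (0 : ℝ),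
      C * r ^ ((1 - δ) * (δ - α)) ≤ F r) :
    ∃ o : ℝ → ℝ, Tendsto o (𝓝[>] 0) (𝓝 0) ∧ ∀ᶠ r in 𝓝[>] (0 : ℝ), F r = (1 / r) ^ (α + o r) := by
  have hr1 : ∀ᶠ r in 𝓝[>] (0 : ℝ), r < 1 :=
    nhdsWithin_le_nhds (gt_mem_nhds (zero_lt_one : (0 : ℝ) < 1))
  have hL : Tendsto (fun r : ℝ => -Real.log r) (𝓝[>] 0) atTop :=
    tendsto_neg_atBot_atTop.comp Real.tendsto_log_nhdsGT_zero
  have hdiv : ∀ x : ℝ, Tendsto (fun r : ℝ => x / -Real.log r) (𝓝[>] 0) (𝓝 0) := fun x =>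
    hL.const_div_atTop x
  have hF : ∀ᶠ r in 𝓝[>] (0 : ℝ), 0 < F r := by
    obtain ⟨C, hC, h⟩ := hlow (1 / 2) (by norm_num) (by norm_num)
    filter_upwards [h, self_mem_nhdsWithin] with r h hr0
    exact (mul_pos hC (Real.rpow_pos_of_pos hr0 _)).trans_le h
  refine ⟨fun r => Real.log (F r) / -Real.log r - α, ?_, ?_⟩
  · refine tendsto_order.2 ⟨fun e he => ?_, fun e he => ?_⟩
    -- Here `(1 - δ) * (α - δ) ≥ α - δ * (1 + α) ≥ α + e / 2`; the other half of `e` absorbs the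
    -- constant `C`.
    · set δ := min (1 / 2) (-e / (2 * (1 + α))) with hδ
      have hδ0 : 0 < δ := lt_min (by norm_num) (div_pos (by linarith) (by linarith))
      have hδ1 : δ < 1 := (min_le_left _ _).trans_lt (by norm_num)
      have hδe : δ * (2 * (1 + α)) ≤ -e := by
        rw [← le_div_iff₀ (by linarith)]; exact min_le_right _ _
      obtain ⟨C, hC, h⟩ := hlow δ hδ0 hδ1
      filter_upwards [h, self_mem_nhdsWithin, hr1,
        (hdiv (Real.log C)).eventually (lt_mem_nhds (show e / 2 < 0 by linarith))]
        with r h hr0 hr1 hC'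
      have hlog : 0 < -Real.log r := neg_pos.2 (Real.log_neg hr0 hr1)
      have h1 := Real.log_le_log (mul_pos hC (Real.rpow_pos_of_pos hr0 _)) h
      rw [Real.log_mul hC.ne' (Real.rpow_pos_of_pos hr0 _).ne', Real.log_rpow hr0] at h1
      have h2 : Real.log C / -Real.log r + (1 - δ) * (α - δ) ≤ Real.log (F r) / -Real.log r := by
        rw [le_div_iff₀ hlog, add_mul, div_mul_cancel₀ _ hlog.ne']
        linarith
      nlinarith
    · filter_upwards [hup, hF, self_mem_nhdsWithin, hr1,
        (hdiv (Real.log B)).eventually (gt_mem_nhds he)] with r h hFr hr0 hr1 hB'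
      have hlog : 0 < -Real.log r := neg_pos.2 (Real.log_neg hr0 hr1)
      have h1 := Real.log_le_log hFr h
      rw [Real.log_mul hB.ne' (Real.rpow_pos_of_pos hr0 _).ne', Real.log_rpow hr0] at h1
      have h2 : Real.log (F r) / -Real.log r ≤ Real.log B / -Real.log r + α := by
        rw [div_le_iff₀ hlog, add_mul, div_mul_cancel₀ _ hlog.ne']
        linarith
      linarith
  · filter_upwards [hF, self_mem_nhdsWithin, hr1] with r hFr hr0 hr1
    have hr0 : 0 < r := hr0
    have hlog : Real.log r ≠ 0 := (Real.log_neg hr0 hr1).ne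
    rw [add_sub_cancel, Real.rpow_def_of_pos (by positivity), one_div, Real.log_inv,
      mul_div_cancel₀ _ (neg_ne_zero.2 hlog), Real.exp_log hFr]

end RWRE

end

theorem proposition1p2 (η : Measure RWRE.Env) [IsProbabilityMeasure η]
    (h_indep : iIndepFun (fun (i : ℤ) (ω : RWRE.Env) => ω i) η)
    (h_ident : ∀ i : ℤ, IdentDistrib (fun ω : RWRE.Env => ω i) (fun ω : RWRE.Env => ω 0) η η)
    (h_ellip : ∃ ε₀ : ℝ, 0 < ε₀ ∧ ∀ᵐ ω ∂η, ε₀ ≤ (ω 0 : ℝ) ∧ (ω 0 : ℝ) ≤ 1 - ε₀)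
    (h_rec : ∫ ω, RWRE.logRho 0 ω ∂η = 0)
    (h_var : 0 < variance (RWRE.logRho 0) η)
    (α : ℝ) (hα : 0 < α) :
    ∃ o : ℝ → ℝ, Tendsto o (𝓝[>] 0) (𝓝 0) ∧
      ∀ᶠ r in 𝓝[>] (0 : ℝ),
        Integrable (fun S => RWRE.powExp α r (RWRE.hittingTime 1 S)) (RWRE.annealedLaw η) ∧
        ∫ S, RWRE.powExp α r (RWRE.hittingTime 1 S) ∂(RWRE.annealedLaw η) =
          (1 / r) ^ (α + o r) := by
  have : IsProbabilityMeasure (RWRE.annealedLaw η) :=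
    ⟨by simp [RWRE.annealedLaw_apply η MeasurableSet.univ]⟩
  obtain ⟨o, ho, h⟩ := RWRE.exists_exponent
    (F := fun r => ∫ S, RWRE.powExp α r (RWRE.hittingTime 1 S) ∂(RWRE.annealedLaw η))
    (B := α ^ α) hα (by positivity) (by
      filter_upwards [self_mem_nhdsWithin] with r hr
      have hr : 0 < r := hr
      refine (integral_mono (RWRE.integrable_powExp hα hr _) (integrable_const _)
        fun S => RWRE.powExp_le hα hr _).trans (le_of_eq ?_)
      simp only [integral_const, probReal_univ, smul_eq_mul, one_mul]
      rw [Real.div_rpow hα.le hr.le, Real.rpow_neg hr.le, div_eq_mul_inv])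
    fun δ hδ hδ1 =>
      RWRE.exists_le_integral_powExp η h_indep h_ident h_ellip h_rec h_var hα hδ hδ1
  refine ⟨o, ho, ?_⟩
  filter_upwards [h, self_mem_nhdsWithin] with r hr hr0
  exact ⟨RWRE.integrable_powExp hα hr0 _, hr⟩
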